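/- A labelled Markov chain (LMC) $\mathcal M=\langle S,\Sigma,\mu,\ell\rangle$ consists of a finite set $S$ of states, a finite alphabet $\Sigma$, a transition function $\mu$ assigning to each $s\in S$ a probability distribution $\mu_s$ on $S$ with rational values, and a labelling $\ell:S\to\Sigma$. Write $\|q\|$ for the number of bits of the numerator (in absolute value) and denominator of a rational $q$ in lowest terms, and let the size of $\mathcal M$ be $|\mathcal M|=\sum_{s\in S}(1+b)+\sum_{s,u\in S}\|\mu_s(u)\|$, where $b$ is the number of binary digits of $|\Sigma|$. For a real $\alpha\ge 1$ let $\Delta_\alpha(x,y)=\max\{x-\alpha y,\;y-\alpha x,\;0\}$. For $d:S\times S\to[0,1]$ and distributions $\mu,\mu'$ on $S$ let $$K_\alpha(d)(\mu,\mu')=\sup\Big\{\Delta_\alpha\Big(\sum_{u}f(u)\mu(u),\sum_{u}f(u)\mu'(u)\Big)\;:\;f:S\to[0,1],\ \Delta_\alpha(f(v),f(v'))\le d(v,v')\text{ for all }v,v'\in S\Big\},$$ and let $\Gamma_\alpha(d)(s,s')=K_\alpha(d)(\mu_s,\mu_{s'})$ if $\ell(s)=\ell(s')$, and $\Gamma_\alpha(d)(s,s')=1$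 otherwise. The operator $\Gamma_\alpha$ is monotone on $[0,1]^{S\times S}$ with the pointwise order; let the skewed bisimilarity distance $\mathrm{bd}_\alpha:S\times S\to[0,1]$ be its least fixed point. **Theorem.** There is a polynomial $p$ such that for every rational $\alpha\ge 1$, every LMC $\mathcal M$ and all states $s,s'$ of $\mathcal M$, the value $\mathrm{bd}_\alpha(s,s')$ is rational and $\|\mathrm{bd}_\alpha(s,s')\|\le p(|\mathcal M|+\|\alpha\|)$. In particular, for each fixed rational $\alpha\ge1$, all values of $\mathrm{bd}_\alpha$ are rational and of binary size bounded by a polynomial in $|\mathcal M|$. -/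

import Mathlib

open scoped unitInterval

/-- A labelled Markov chain with state space `S` and alphabet `A` (both finite where it is used),
with rational transition probabilities. -/
structure LMC (S A : Type*) [Fintype S] where
  /-- transition probabilities, `trans s u` is the probability of moving from `s` to `u` -/
  trans : S → S → ℚ
  trans_nonneg : ∀ s u, 0 ≤ trans s u
  trans_sum : ∀ s, ∑ u, trans s u = 1
  /-- labelling function -/
  label : S → A

/-- Bit size of a rational number, written as the pair of binary integers (numerator and
denominator) in lowest terms. -/
def ratSize (q : ℚ) : ℕ := Nat.size q.num.natAbs + Nat.size q.den

/-- The skewed distance on the reals. -/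
noncomputable def skewDist (α x y : ℝ) : ℝ := max (max (x - α * y) (y - α * x)) 0

/-- The expectation of `f` under a probability distribution on the finite set `S`. -/
noncomputable def expect {S : Type*} [Fintype S] (f : S → I) (μ : stdSimplex ℝ S) : ℝ :=
  ∑ u, (f u : ℝ) * μ.1 u

/-- The values over which the supremum in the skewed Kantorovich distance is taken. -/
def skewKantorovichSet {S : Type*} [Fintype S] (α : ℝ) (d : S → S → I)
    (μ ν : stdSimplex ℝ S) : Set ℝ :=
  {x | ∃ f : S → I, (∀ v w, skewDist α (f v) (f w) ≤ d v w) ∧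
    x = skewDist α (expect f μ) (expect f ν)}

/-- The skewed Kantorovich distance between two distributions on `S`. -/
noncomputable def skewKantorovich {S : Type*} [Fintype S] (α : ℝ) (d : S → S → I)
    (μ ν : stdSimplex ℝ S) : ℝ :=
  sSup (skewKantorovichSet α d μ ν)

theorem expect_mem {S : Type*} [Fintype S] (f : S → I) (μ : stdSimplex ℝ S) :
    expect f μ ∈ I := by
  refine ⟨Finset.sum_nonneg fun u _ => mul_nonneg (f u).2.1 (μ.2.1 u), ?_⟩
  calc expect f μ ≤ ∑ u, μ.1 u :=
        Finset.sum_le_sum fun u _ => mul_le_of_le_one_left (μ.2.1 u) (f u).2.2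
    _ = 1 := μ.2.2

theorem skewDist_mem {α : ℝ} (hα : 1 ≤ α) {x y : ℝ} (hx : x ∈ I) (hy : y ∈ I) :
    skewDist α x y ∈ I := by
  obtain ⟨hx0, hx1⟩ := hx
  obtain ⟨hy0, hy1⟩ := hy
  refine ⟨le_max_right _ _, max_le (max_le ?_ ?_) zero_le_one⟩ <;> nlinarith

theorem skewKantorovichSet_subset {S : Type*} [Fintype S] {α : ℝ} (hα : 1 ≤ α)
    (d : S → S → I) (μ ν : stdSimplex ℝ S) : skewKantorovichSet α d μ ν ⊆ I := by
  rintro x ⟨f, -, rfl⟩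
  exact skewDist_mem hα (expect_mem f μ) (expect_mem f ν)

theorem skewKantorovichSet_nonempty {S : Type*} [Fintype S] (α : ℝ)
    (d : S → S → I) (μ ν : stdSimplex ℝ S) : (skewKantorovichSet α d μ ν).Nonempty :=
  ⟨_, fun _ => 0, fun v w => by simpa [skewDist] using (d v w).2.1, rfl⟩

theorem skewKantorovichSet_bddAbove {S : Type*} [Fintype S] {α : ℝ} (hα : 1 ≤ α)
    (d : S → S → I) (μ ν : stdSimplex ℝ S) : BddAbove (skewKantorovichSet α d μ ν) :=
  ⟨1, fun _ hx => (skewKantorovichSet_subset hα d μ ν hx).2⟩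

theorem skewKantorovich_mem {S : Type*} [Fintype S] {α : ℝ} (hα : 1 ≤ α)
    (d : S → S → I) (μ ν : stdSimplex ℝ S) : skewKantorovich α d μ ν ∈ I :=
  ⟨Real.sSup_nonneg fun _ hx => (skewKantorovichSet_subset hα d μ ν hx).1,
    csSup_le (skewKantorovichSet_nonempty α d μ ν)
      fun _ hx => (skewKantorovichSet_subset hα d μ ν hx).2⟩

theorem skewKantorovich_mono {S : Type*} [Fintype S] {α : ℝ} (hα : 1 ≤ α)
    {d e : S → S → I} (h : d ≤ e) (μ ν : stdSimplex ℝ S) :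
    skewKantorovich α d μ ν ≤ skewKantorovich α e μ ν := by
  refine csSup_le_csSup (skewKantorovichSet_bddAbove hα e μ ν)
    (skewKantorovichSet_nonempty α d μ ν) ?_
  rintro x ⟨f, hf, rfl⟩
  exact ⟨f, fun v w => (hf v w).trans (h v w), rfl⟩

namespace LMC

/-- The bit size of a labelled Markov chain: for each state, one unit and the bits that write
down its label, and for each pair of states the bit size of the transition probability. -/
def size {S A : Type*} [Fintype S] [Fintype A] (M : LMC S A) : ℕ :=
  (∑ _s : S, (1 + Nat.size (Fintype.card A))) + ∑ s : S, ∑ u : S, ratSize (M.trans s u)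

/-- The distribution of the successor of the state `s`. -/
noncomputable def next {S A : Type*} [Fintype S] (M : LMC S A) (s : S) : stdSimplex ℝ S :=
  ⟨fun u => (M.trans s u : ℝ), fun u => Rat.cast_nonneg.2 (M.trans_nonneg s u),
    by simpa using congrArg (fun q : ℚ => (q : ℝ)) (M.trans_sum s)⟩

open Classical in
/-- The monotone operator on `[0,1]`-valued functions on pairs of states (ordered pointwise)
whose least fixed point is the skewed bisimilarity distance. -/
noncomputable def gamma {S A : Type*} [Fintype S] (M : LMC S A) (α : ℝ) (hα : 1 ≤ α) :
    (S → S → I) →o (S → S → I) where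
  toFun d s t :=
    if M.label s = M.label t then
      ⟨skewKantorovich α d (M.next s) (M.next t), skewKantorovich_mem hα d _ _⟩
    else 1
  monotone' d e h s t := by
    dsimp only
    split_ifs
    · exact skewKantorovich_mono hα h _ _
    · exact le_rfl

/-- The skewed bisimilarity distance: the least fixed point of `gamma`. -/
noncomputable def bd {S A : Type*} [Fintype S] (M : LMC S A) (α : ℝ) (hα : 1 ≤ α) :
    S → S → I :=
  OrderHom.lfp (M.gamma α hα)

end LMC

/-! The distance turns out to be the unique minimiser of the coordinate sum in a linear program with
short integer data, and basic solutions of such a program are rational and short.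

Each side of `skewKantorovich` at a pair of states is a linear program in `f` whose constraint
bounds are the values of `d`. In its dual, `d` enters only the objective. A dual solution that is
good for `d = bd` therefore stays feasible for every `e` and, by weak duality, bounds that side for
`e` by an expression linear in `e`. By `exists_small_skewDual` this solution can be taken with short
integer coefficients, although it is chosen through the unknown real values of `bd`.

Freezing one such certificate per pair and side (`exists_small_certificate`) gives linear
inequalities that hold for `bd` and force any `e` in the unit cube satisfying them to be a pre-fixed
point. By `exists_nat_feasible_le` there is a short rational `e` satisfying them whose coordinate
sum is at most that of `bd`. Leastness gives `bd ≤ e` pointwise, so the two coincide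
(`exists_rat_bd_eq`). -/

/-! ### Linear programming: basic solutions, closed cones, Farkas, duality. -/

/-- Carathéodory reduction that also controls the cost. A linear dependency inside the support,
signed so as not to raise the cost, is followed until a coordinate vanishes; the support shrinks,
and induction on its size finishes. -/
theorem exists_nonneg_linearIndepOn_support {κ E : Type*} [Fintype κ] [AddCommGroup E] [Module ℝ E]
    (v : κ → E) {c : κ → ℝ} (hc : ∀ j, 0 ≤ c j) (x : κ → ℝ) (hx : ∀ j, 0 ≤ x j) :
    ∃ y : κ → ℝ, (∀ j, 0 ≤ y j) ∧ ∑ j, y j • v j = ∑ j, x j • v j ∧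
      ∑ j, c j * y j ≤ ∑ j, c j * x j ∧ LinearIndepOn ℝ v {j | y j ≠ 0} := by
  classical
  induction hn : (Finset.univ.filter fun j => x j ≠ 0).card using Nat.strong_induction_on
    generalizing x with
  | _ n ih =>
  by_cases hli : LinearIndepOn ℝ v {j | x j ≠ 0}
  · exact ⟨x, hx, rfl, le_rfl, hli⟩
  -- The negative entry makes the move stop. Since `c ≥ 0`, a direction of negative cost has one
  -- automatically; at zero cost either sign of `g` is allowed, and one of them has a negative
  -- entry.
  obtain ⟨z, hzs, hzv, hzc, j₁, hj₁⟩ : ∃ z : κ → ℝ, (∀ j, x j = 0 → z j = 0) ∧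
      ∑ j, z j • v j = 0 ∧ ∑ j, c j * z j ≤ 0 ∧ ∃ j, z j < 0 := by
    obtain ⟨g, hgs, hgv, j₀, hj₀⟩ : ∃ g : κ → ℝ, (∀ j, x j = 0 → g j = 0) ∧
        ∑ j, g j • v j = 0 ∧ ∃ j, g j ≠ 0 := by
      have hset : {j | x j ≠ 0} = ((Finset.univ.filter fun j => x j ≠ 0 : Finset κ) : Set κ) := by
        ext; simp
      rw [hset, linearIndepOn_finset_iff] at hli
      push Not at hli
      obtain ⟨g, hg, j₀, hj₀, hne⟩ := hli
      refine ⟨fun j => if x j ≠ 0 then g j else 0, fun j hj => by simp [hj], ?_, j₀, ?_⟩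
      · simp only [ite_smul, zero_smul]
        rw [← Finset.sum_filter]
        exact hg
      · have := (Finset.mem_filter.1 hj₀).2
        simpa [this] using hne
    have neg_mem : ∀ h : κ → ℝ, ∑ j, c j * h j < 0 → ∃ j, h j < 0 := by
      intro h hlt
      by_contra! hcon
      exact hlt.not_ge (Finset.sum_nonneg fun j _ => mul_nonneg (hc j) (hcon j))
    have hns : ∀ j, x j = 0 → (-g) j = 0 := fun j hj => by simp [hgs j hj]
    have hnv : ∑ j, (-g) j • v j = 0 := by simp [hgv]
    have hnc : ∑ j, c j * (-g) j = -∑ j, c j * g j := by simp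
    rcases lt_trichotomy (∑ j, c j * g j) 0 with h | h | h
    · exact ⟨g, hgs, hgv, h.le, neg_mem g h⟩
    · rcases lt_or_gt_of_ne hj₀ with h' | h'
      · exact ⟨g, hgs, hgv, h.le, j₀, h'⟩
      · exact ⟨-g, hns, hnv, by rw [hnc, h, neg_zero], j₀, by simpa using h'⟩
    · exact ⟨-g, hns, hnv, by rw [hnc]; linarith, neg_mem _ (by rw [hnc]; linarith)⟩
  -- Ratio test: `t` below is the largest step along `z` that keeps all coordinates nonnegative.
  obtain ⟨j₀, hj₀, hmin⟩ := Finset.exists_min_image (Finset.univ.filter fun j => z j < 0)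
    (fun j => x j / (-z j)) ⟨j₁, by simpa using hj₁⟩
  have hj₀' : z j₀ < 0 := by simpa using hj₀
  set t := x j₀ / (-z j₀) with ht
  have ht0 : 0 ≤ t := div_nonneg (hx _) (by linarith)
  have hy0 : x j₀ + t * z j₀ = 0 := by
    rw [ht]; field_simp [hj₀'.ne]; ring
  obtain ⟨y, h0, hv, hcy, hy⟩ := ih (Finset.univ.filter fun j => x j + t * z j ≠ 0).card (by
      rw [← hn]
      refine Finset.card_lt_card (Finset.ssubset_iff_of_subset ?_ |>.2 ⟨j₀, ?_, ?_⟩)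
      · intro j hj
        simp only [Finset.mem_filter, Finset.mem_univ, true_and] at hj ⊢
        contrapose! hj
        simp [hj, hzs j hj]
      · simp only [Finset.mem_filter, Finset.mem_univ, true_and]
        exact fun h => hj₀'.ne (hzs _ h)
      · simp [hy0]) (fun j => x j + t * z j) (fun j => by
      rcases lt_or_ge (z j) 0 with h | h
      · have := hmin j (by simpa using h)
        rw [le_div_iff₀ (by linarith)] at this
        linarith
      · have := hx j
        positivity) rfl
  refine ⟨y, h0, ?_, hcy.trans ?_, hy⟩
  · rw [hv]
    simp only [add_smul, mul_smul, Finset.sum_add_distrib, ← Finset.smul_sum, hzv, smul_zero,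
      add_zero]
  · have : ∑ j, c j * (x j + t * z j) = ∑ j, c j * x j + t * ∑ j, c j * z j := by
      rw [Finset.mul_sum, ← Finset.sum_add_distrib]
      exact Finset.sum_congr rfl fun j _ => by ring
    rw [this]
    nlinarith

/-- Finitely generated cones in finite-dimensional spaces are closed. -/
theorem isClosed_setOf_nonneg_sum_smul {κ E : Type*} [Fintype κ] [AddCommGroup E] [Module ℝ E]
    [TopologicalSpace E] [IsTopologicalAddGroup E] [ContinuousSMul ℝ E] [T2Space E]
    (v : κ → E) : IsClosed {e | ∃ x : κ → ℝ, (∀ j, 0 ≤ x j) ∧ ∑ j, x j • v j = e} := by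
  classical
  -- Over an independent subfamily the cone is the image of a closed orthant under an injective
  -- linear map from a finite-dimensional space, hence a closed embedding. The whole cone is a
  -- finite union of these.
  have hclosed : ∀ J : Finset κ, LinearIndepOn ℝ v (J : Set κ) →
      IsClosed ((fun x : J → ℝ => ∑ j, x j • v j) '' {x | ∀ j, 0 ≤ x j}) := by
    intro J hJ
    have hinj : LinearMap.ker (Fintype.linearCombination ℝ (fun j : J => v j)) = ⊥ := by
      have := Fintype.linearIndependent_iff.1 hJ
      rw [LinearMap.ker_eq_bot']
      intro m hm
      ext j
      exact this m (by simpa [Fintype.linearCombination_apply] using hm) j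
    have hemb := LinearMap.isClosedEmbedding_of_injective hinj
    have := hemb.isClosedMap {x | ∀ j, 0 ≤ x j} (by
      simp only [Set.ofPred_forall]
      exact isClosed_iInter fun j => isClosed_le continuous_const (continuous_apply j))
    exact this
  have hunion : {e | ∃ x : κ → ℝ, (∀ j, 0 ≤ x j) ∧ ∑ j, x j • v j = e} =
      ⋃ J ∈ {J : Finset κ | LinearIndepOn ℝ v (J : Set κ)},
        (fun x : J → ℝ => ∑ j, x j • v j) '' {x | ∀ j, 0 ≤ x j} := by
    ext e
    simp only [Set.mem_ofPred_eq, Set.mem_iUnion, Set.mem_image, exists_prop]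
    constructor
    · rintro ⟨x, hx, rfl⟩
      obtain ⟨y, hy0, hyv, -, hy⟩ :=
        exists_nonneg_linearIndepOn_support v (c := 0) (fun _ => le_rfl) x hx
      refine ⟨Finset.univ.filter fun j => y j ≠ 0, by simpa using hy, fun j => y j,
        fun j => hy0 j, ?_⟩
      rw [← hyv, Finset.sum_coe_sort _ (fun j => y j • v j), Finset.sum_filter]
      exact Finset.sum_congr rfl fun j _ => by by_cases h : y j = 0 <;> simp [h]
    · rintro ⟨J, -, x, hx, rfl⟩
      refine ⟨fun j => if h : j ∈ J then x ⟨j, h⟩ else 0, fun j => ?_, ?_⟩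
      · dsimp only
        split_ifs
        exacts [hx _, le_rfl]
      · rw [← Finset.sum_subset J.subset_univ (fun j _ h => by simp [h]), ← Finset.sum_coe_sort]
        exact Finset.sum_congr rfl fun j _ => by simp
  rw [hunion]
  exact (Set.toFinite _).isClosed_biUnion fun J hJ => hclosed J hJ

/-- **Farkas' lemma**. -/
theorem exists_nonneg_sum_smul_eq_of_forall_dual {κ E : Type*} [Fintype κ] [AddCommGroup E]
    [Module ℝ E] [TopologicalSpace E] [IsTopologicalAddGroup E] [ContinuousSMul ℝ E] [T2Space E]
    [LocallyConvexSpace ℝ E] (v : κ → E) (b : E)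
    (h : ∀ φ : E →L[ℝ] ℝ, (∀ j, 0 ≤ φ (v j)) → 0 ≤ φ b) :
    ∃ x : κ → ℝ, (∀ j, 0 ≤ x j) ∧ ∑ j, x j • v j = b := by
  classical
  by_contra hb
  set C : Set E := {e | ∃ x : κ → ℝ, (∀ j, 0 ≤ x j) ∧ ∑ j, x j • v j = e} with hC
  have hconv : Convex ℝ C := by
    rintro _ ⟨x, hx, rfl⟩ _ ⟨y, hy, rfl⟩ a c ha hc -
    refine ⟨fun j => a * x j + c * y j, fun j => ?_, ?_⟩
    · have := hx j
      have := hy j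
      positivity
    · simp only [add_smul, mul_smul, Finset.sum_add_distrib, Finset.smul_sum]
  obtain ⟨φ, u, hφb, hφ⟩ := geometric_hahn_banach_point_closed hconv
    (isClosed_setOf_nonneg_sum_smul v) hb
  have hu : u < 0 := by simpa using hφ 0 ⟨0, by simp, by simp⟩
  refine (h φ fun j => ?_).not_gt (hφb.trans hu)
  by_contra! hj
  -- If `φ (v j) < 0`, this multiple lies in the cone and `φ` takes exactly the value `u` there,
  -- against strict separation.
  have := hφ ((u / φ (v j)) • v j) ⟨Pi.single j (u / φ (v j)), fun i => ?_, ?_⟩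
  · rw [map_smul, smul_eq_mul, div_mul_cancel₀ _ hj.ne] at this
    exact lt_irrefl _ this
  · by_cases hij : i = j
    · subst hij
      simpa using (div_pos_of_neg_of_neg hu hj).le
    · simp [hij]
  · rw [Finset.sum_eq_single j] <;> simp +contextual

/-- **Linear programming duality**: a bound on the objective of the maximisation problem is
attained by a feasible point of a feasible minimisation problem. -/
theorem exists_feasible_le_of_forall_dual_le {ι κ : Type*} [Fintype ι] [Fintype κ]
    (A : ι → κ → ℝ) (b : ι → ℝ) (c : κ → ℝ) (V : ℝ)
    {x₀ : κ → ℝ} (hx₀ : ∀ j, 0 ≤ x₀ j) (hAx₀ : ∀ i, ∑ j, A i j * x₀ j ≤ b i)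
    (hV : ∀ y : ι → ℝ, (∀ i, 0 ≤ y i) → (∀ j, 0 ≤ c j + ∑ i, y i * A i j) →
      -∑ i, y i * b i ≤ V) :
    ∃ x : κ → ℝ, (∀ j, 0 ≤ x j) ∧ (∀ i, ∑ j, A i j * x j ≤ b i) ∧ ∑ j, c j * x j ≤ V := by
  classical
  -- Farkas for the system `A x + slack = b`, `c · x + slack = V`: the generators are the columns of
  -- `A` extended by their costs, together with the slack directions.
  obtain ⟨x, hx, hxb⟩ := exists_nonneg_sum_smul_eq_of_forall_dual
    (κ := (κ ⊕ ι) ⊕ Unit) (E := (ι → ℝ) × ℝ)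
    (Sum.elim (Sum.elim (fun j => (fun i => A i j, c j)) fun i => (Pi.single i 1, 0))
      fun _ => (0, 1)) (b, V) (by
    intro φ hφ
    set y : ι → ℝ := fun i => φ (Pi.single i 1, 0) with hy
    set τ : ℝ := φ (0, 1) with hτ
    have hφe : ∀ (w : ι → ℝ) (r : ℝ), φ (w, r) = ∑ i, y i * w i + r * τ := by
      intro w r
      have : (w, r) = ∑ i, w i • ((Pi.single i 1, 0) : (ι → ℝ) × ℝ) + r • ((0, 1) : (ι → ℝ) × ℝ) := by
        ext i
        · simp [Prod.fst_sum, Finset.sum_apply, Pi.single_apply]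
        · simp [Prod.snd_sum]
      rw [this, map_add, map_sum, map_smul]
      simp only [map_smul, smul_eq_mul]
      congr 1
      exact Finset.sum_congr rfl fun i _ => mul_comm _ _
    have hy0 : ∀ i, 0 ≤ y i := fun i => hφ (Sum.inl (Sum.inr i))
    have hτ0 : 0 ≤ τ := hφ (Sum.inr ())
    have hcol : ∀ j, 0 ≤ ∑ i, y i * A i j + c j * τ := fun j => by
      have := hφ (Sum.inl (Sum.inl j))
      simpa [hφe] using this
    rw [hφe]
    -- For `τ = 0` the functional ignores the objective, and feasibility of `x₀` settles the sign;
    -- for `τ > 0`, `y / τ` is dual feasible and `hV` applies.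
    rcases hτ0.eq_or_lt with h0 | hpos
    · have h1 : 0 ≤ ∑ j, (∑ i, y i * A i j) * x₀ j :=
        Finset.sum_nonneg fun j _ => mul_nonneg (by simpa [← h0] using hcol j) (hx₀ j)
      have h2 : ∑ j, (∑ i, y i * A i j) * x₀ j = ∑ i, y i * ∑ j, A i j * x₀ j := by
        simp only [Finset.sum_mul, Finset.mul_sum]
        rw [Finset.sum_comm]
        exact Finset.sum_congr rfl fun i _ => Finset.sum_congr rfl fun j _ => mul_assoc _ _ _
      have h3 : ∑ i, y i * ∑ j, A i j * x₀ j ≤ ∑ i, y i * b i :=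
        Finset.sum_le_sum fun i _ => mul_le_mul_of_nonneg_left (hAx₀ i) (hy0 i)
      rw [← h0]
      linarith
    · have := hV (fun i => y i / τ) (fun i => div_nonneg (hy0 i) hτ0) (fun j => by
        have : c j + ∑ i, y i / τ * A i j = (∑ i, y i * A i j + c j * τ) / τ := by
          rw [add_div, mul_div_cancel_right₀ _ hpos.ne', Finset.sum_div, add_comm]
          simp only [div_mul_eq_mul_div]
        rw [this]
        exact div_nonneg (hcol j) hτ0)
      have h4 : ∑ i, y i / τ * b i = (∑ i, y i * b i) / τ := by
        rw [Finset.sum_div]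
        simp only [div_mul_eq_mul_div]
      rw [h4, neg_le_iff_add_nonneg, ← mul_nonneg_iff_of_pos_right hpos, add_mul,
        div_mul_cancel₀ _ hpos.ne'] at this
      linarith)
  have h1 := congrArg Prod.fst hxb
  have h2 := congrArg Prod.snd hxb
  simp only [Fintype.sum_sum_type, Prod.fst_add, Prod.snd_add, Prod.fst_sum, Prod.snd_sum,
    Sum.elim_inl, Sum.elim_inr, Prod.smul_fst, Prod.smul_snd, Finset.univ_unique,
    Finset.sum_singleton, smul_zero, add_zero, smul_eq_mul, mul_one, mul_zero,
    Finset.sum_const_zero] at h1 h2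
  refine ⟨fun j => x (.inl (.inl j)), fun j => hx _, fun i => ?_, ?_⟩
  · have := congrFun h1 i
    simp only [Pi.add_apply, Finset.sum_apply, Pi.smul_apply, smul_eq_mul, Pi.single_apply,
      mul_ite, mul_one, mul_zero, Finset.sum_ite_eq, Finset.mem_univ, if_true] at this
    have h3 := hx (.inl (.inr i))
    simp only [mul_comm (A i _)]
    linarith
  · have h3 := hx (.inr default)
    simp only [mul_comm (c _)]
    linarith

/-! ### Size bounds for basic solutions of integer programs. -/

open Matrix in
/-- Cramer's rule: a nonnegative solution of an integer linear system with linearly independent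
columns has a common denominator and numerators of bounded size. -/
theorem exists_natCast_eq_mul_of_linearIndependent {ι κ : Type*} [Fintype ι] [Fintype κ]
    (W : Matrix ι κ ℤ) (b : ι → ℤ) {k a : ℕ} (hk : Fintype.card ι ≤ k) (hka : k ≤ 2 ^ a)
    (hW : ∀ i j, |W i j| ≤ 2 ^ a) (hb : ∀ i, |b i| ≤ 2 ^ a)
    (hli : LinearIndependent ℝ (fun j i => (W i j : ℝ))) {y : κ → ℝ} (hy : ∀ j, 0 ≤ y j)
    (hWy : ∀ i, ∑ j, (W i j : ℝ) * y j = b i) :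
    ∃ (D : ℕ) (n : κ → ℕ), 0 < D ∧ D ≤ 2 ^ (4 * a * k) ∧ (∀ j, n j ≤ 2 ^ (4 * a * k)) ∧
      ∀ j, (n j : ℝ) = D * y j := by
  classical
  set WR : Matrix ι κ ℝ := W.map (Int.castRingHom ℝ) with hWR
  -- `W` need not be square, so Cramer's rule is applied to the normal equations `Wᵀ W y = Wᵀ b`,
  -- whose Gram matrix is positive definite because the columns are independent.
  set G : Matrix κ κ ℤ := Wᵀ * W with hG
  set r : κ → ℤ := Wᵀ *ᵥ b with hr
  have hGR : G.map (Int.castRingHom ℝ) = WRᵀ * WR := by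
    rw [hG, Matrix.map_mul, hWR, Matrix.transpose_map]
  have hpos : (0 : ℝ) < (G.map (Int.castRingHom ℝ)).det := by
    rw [hGR, ← Matrix.conjTranspose_eq_transpose_of_trivial]
    exact (Matrix.PosDef.conjTranspose_mul_self WR (Matrix.mulVec_injective_iff.2 hli)).det_pos
  have hdet : ((G.det : ℤ) : ℝ) = (G.map (Int.castRingHom ℝ)).det :=
    RingHom.map_det (Int.castRingHom ℝ) G
  have hcard : Fintype.card κ ≤ k := by
    have := hli.fintype_card_le_finrank
    rw [Module.finrank_fintype_fun_eq_card] at this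
    exact this.trans hk
  have hdot : ∀ u w : ι → ℤ, (∀ i, |u i| ≤ 2 ^ a) → (∀ i, |w i| ≤ 2 ^ a) →
      |∑ i, u i * w i| ≤ 2 ^ (3 * a) := by
    intro u w hu hw
    calc |∑ i, u i * w i| ≤ ∑ i : ι, (2 ^ a * 2 ^ a : ℤ) := by
          refine (Finset.abs_sum_le_sum_abs _ _).trans (Finset.sum_le_sum fun i _ => ?_)
          rw [abs_mul]
          exact mul_le_mul (hu i) (hw i) (abs_nonneg _) (by positivity)
      _ = Fintype.card ι * (2 ^ a * 2 ^ a) := by simp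
      _ ≤ 2 ^ a * (2 ^ a * 2 ^ a) := by
          gcongr
          exact_mod_cast hk.trans hka
      _ = 2 ^ (3 * a) := by ring
  -- Leibniz expansion: the factorial costs `a * k` bits and the products of entries `3 * a * k`.
  have hdetle : ∀ N : Matrix κ κ ℤ, (∀ i j, |N i j| ≤ 2 ^ (3 * a)) → |N.det| ≤ 2 ^ (4 * a * k) := by
    intro N hN
    have h1 := Matrix.det_le (abv := (AbsoluteValue.abs : AbsoluteValue ℤ ℤ)) hN
    refine h1.trans ?_
    rw [nsmul_eq_mul]
    calc (((Fintype.card κ).factorial : ℕ) : ℤ) * (2 ^ (3 * a)) ^ Fintype.card κ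
        ≤ (2 ^ a) ^ k * (2 ^ (3 * a)) ^ k := by
          gcongr
          · have : (Fintype.card κ).factorial ≤ (2 ^ a) ^ k :=
              calc _ ≤ Fintype.card κ ^ Fintype.card κ := Nat.factorial_le_pow _
                _ ≤ (2 ^ a) ^ Fintype.card κ := by gcongr; exact hcard.trans hka
                _ ≤ (2 ^ a) ^ k := by gcongr; exact Nat.one_le_two_pow
            exact_mod_cast this
          · exact one_le_pow₀ (by norm_num)
      _ = 2 ^ (4 * a * k) := by rw [← pow_mul, ← pow_mul, ← pow_add]; ring
  have hGle : ∀ i j, |G i j| ≤ 2 ^ (3 * a) := fun i j =>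
    hdot (fun l => W l i) (fun l => W l j) (fun l => hW l i) fun l => hW l j
  have hrle : ∀ i, |r i| ≤ 2 ^ (3 * a) := fun i => hdot (fun l => W l i) b (fun l => hW l i) hb
  have hcr : ∀ j, ((G.cramer r j : ℤ) : ℝ) = G.det * y j := by
    have h1 : (G.map (Int.castRingHom ℝ)) *ᵥ y = fun j => (r j : ℝ) := by
      have h2 : WR *ᵥ y = fun i => (b i : ℝ) := funext hWy
      rw [hGR, ← Matrix.mulVec_mulVec, h2]
      ext j
      simp [hr, hWR, Matrix.mulVec, dotProduct]
    intro j
    have h3 : (Int.castRingHom ℝ) (G.cramer r j) =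
        (G.map (Int.castRingHom ℝ)).cramer (fun j => (r j : ℝ)) j := by
      rw [Matrix.cramer_apply, Matrix.cramer_apply, RingHom.map_det]
      congr 1
      ext p q
      by_cases hq : q = j
      · subst hq; simp
      · simp [hq]
    rw [hdet, ← eq_intCast (Int.castRingHom ℝ), h3, ← h1, Matrix.cramer_eq_adjugate_mulVec,
      Matrix.mulVec_mulVec, Matrix.adjugate_mul, Matrix.smul_mulVec, Matrix.one_mulVec]
    rfl
  have hGpos : 0 < G.det := by
    rw [← hdet] at hpos
    exact_mod_cast hpos
  have hcr0 : ∀ j, 0 ≤ G.cramer r j := fun j => by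
    have : (0 : ℝ) ≤ G.cramer r j := by
      rw [hcr]
      exact mul_nonneg (by exact_mod_cast hGpos.le) (hy j)
    exact_mod_cast this
  have key : ∀ z : ℤ, |z| ≤ 2 ^ (4 * a * k) → z.natAbs ≤ 2 ^ (4 * a * k) := fun z hz => by
    zify
    exact hz
  have hcast : ∀ z : ℤ, 0 ≤ z → ((z.natAbs : ℕ) : ℝ) = z := fun z hz => by
    rw [← Int.cast_natCast, Int.natAbs_of_nonneg hz]
  refine ⟨G.det.natAbs, fun j => (G.cramer r j).natAbs, Int.natAbs_pos.2 hGpos.ne',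
    key _ (hdetle G hGle), fun j => key _ ?_, fun j => ?_⟩
  · rw [Matrix.cramer_apply]
    refine hdetle _ fun p q => ?_
    rw [Matrix.updateCol_apply]
    split_ifs
    exacts [hrle p, hGle p q]
  · rw [hcast _ (hcr0 j), hcast _ hGpos.le, hcr]

/-- Every feasible point of an integer linear program with nonnegative cost is dominated by a
rational feasible point of bounded size. -/
theorem exists_nat_feasible_le {ι κ : Type*} [Fintype ι] [Fintype κ]
    (A : ι → κ → ℤ) (b : ι → ℤ) {k a : ℕ} (hk : Fintype.card ι ≤ k) (hka : k ≤ 2 ^ a)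
    (hA : ∀ i j, |A i j| ≤ 2 ^ a) (hb : ∀ i, |b i| ≤ 2 ^ a)
    {c x : κ → ℝ} (hc : ∀ j, 0 ≤ c j) (hx : ∀ j, 0 ≤ x j)
    (hAx : ∀ i, ∑ j, (A i j : ℝ) * x j ≤ b i) :
    ∃ (D : ℕ) (n : κ → ℕ), 0 < D ∧ D ≤ 2 ^ (4 * a * k) ∧ (∀ j, n j ≤ 2 ^ (4 * a * k)) ∧
      (∀ i, ∑ j, (A i j : ℝ) * n j ≤ D * b i) ∧ ∑ j, c j * n j ≤ D * ∑ j, c j * x j := by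
  classical
  -- Slack variables of cost zero turn the inequalities into equations. The number of columns never
  -- enters the bound, since independent columns are at most as many as the rows.
  let W : ι → κ ⊕ ι → ℤ := fun i => Sum.elim (A i) (Pi.single i 1)
  obtain ⟨y, hy, hyv, hyc, hli⟩ := exists_nonneg_linearIndepOn_support
    (fun (j : κ ⊕ ι) i => (W i j : ℝ)) (c := Sum.elim c 0)
    (by rintro (j | j) <;> simp [hc]) (Sum.elim x fun i => b i - ∑ j, (A i j : ℝ) * x j)
    (by rintro (j | j) <;> simp [hx, hAx])
  have hWy : ∀ i, ∑ j, (W i j : ℝ) * y j = b i := fun i => by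
    have := congrFun hyv i
    simp only [Finset.sum_apply, Pi.smul_apply, smul_eq_mul] at this
    simp only [mul_comm _ (y _)]
    rw [this]
    simp [W, Pi.single_apply, mul_comm]
  have hsub : ∀ g : κ ⊕ ι → ℝ, ∑ j : {j | y j ≠ 0}, g j * y j = ∑ j, g j * y j := fun g => by
    rw [← Finset.sum_subset (Finset.subset_univ {j | y j ≠ 0}.toFinset)
      (fun j _ hj => by
        have : y j = 0 := by simpa using hj
        simp [this]),
      ← Finset.sum_subtype {j | y j ≠ 0}.toFinset (fun j => by simp) fun j => g j * y j]
  obtain ⟨D, n, hD, hDle, hn, hny⟩ := exists_natCast_eq_mul_of_linearIndependent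
    (fun i (j : {j | y j ≠ 0}) => W i j) b hk hka
    (by
      rintro i ⟨j | j, _⟩
      · exact hA i j
      · simp only [W, Sum.elim_inr, Pi.single_apply]
        split_ifs <;> simp [one_le_pow₀ (show (1 : ℤ) ≤ 2 by norm_num)])
    hb hli (fun j => hy j) (fun i => by rw [hsub (fun j => (W i j : ℝ)), hWy])
  have hN : ∀ j, ∃ m : ℕ, m ≤ 2 ^ (4 * a * k) ∧ (m : ℝ) = D * y j := fun j => by
    by_cases h : y j = 0
    · exact ⟨0, Nat.zero_le _, by simp [h]⟩
    · exact ⟨n ⟨j, h⟩, hn _, hny _⟩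
  choose m hm hmy using hN
  refine ⟨D, fun j => m (.inl j), hD, hDle, fun j => hm _, fun i => ?_, ?_⟩
  · have := hWy i
    simp only [Fintype.sum_sum_type, W, Sum.elim_inl, Sum.elim_inr, Pi.single_apply] at this
    simp only [Int.cast_ite, Int.cast_one, Int.cast_zero, ite_mul, one_mul, zero_mul,
      Finset.sum_ite_eq', Finset.mem_univ, if_true] at this
    have h0 := hy (.inr i)
    calc ∑ j, (A i j : ℝ) * m (.inl j) = D * ∑ j, (A i j : ℝ) * y (.inl j) := by
          rw [Finset.mul_sum]
          exact Finset.sum_congr rfl fun j _ => by rw [hmy]; ring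
      _ ≤ D * b i := by gcongr; linarith
  · simp only [Fintype.sum_sum_type, Sum.elim_inl, Sum.elim_inr, Pi.zero_apply, zero_mul,
      Finset.sum_const_zero, add_zero] at hyc
    calc ∑ j, c j * (m (.inl j) : ℝ) = D * ∑ j, c j * y (.inl j) := by
          rw [Finset.mul_sum]
          exact Finset.sum_congr rfl fun j _ => by rw [hmy]; ring
      _ ≤ D * ∑ j, c j * x j := by gcongr

/-! ### Bit sizes and short dual solutions for the skewed Kantorovich program. -/

theorem ratSize_natCast_div_le (n D : ℕ) (hD : 0 < D) :
    ratSize ((n : ℚ) / D) ≤ Nat.size n + Nat.size D := by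
  have h : (n : ℚ) / D = Rat.divInt n D := by
    rw [Rat.divInt_eq_div]; simp
  refine Nat.add_le_add (Nat.size_le_size ?_) (Nat.size_le_size ?_)
  · rcases Nat.eq_zero_or_pos n with rfl | hn
    · simp
    · have := Rat.num_dvd (n : ℤ) (b := (D : ℤ)) (by exact_mod_cast hD.ne')
      rw [h]
      exact Nat.le_of_dvd hn (by simpa using Int.natAbs_dvd_natAbs.2 this)
  · have := Rat.den_dvd (n : ℤ) (D : ℤ)
    rw [h]
    exact Nat.le_of_dvd hD (by exact_mod_cast this)

theorem num_natAbs_lt_of_ratSize_le {q : ℚ} {P : ℕ} (h : ratSize q ≤ P) :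
    q.num.natAbs < 2 ^ P :=
  Nat.size_le.1 ((Nat.le_add_right _ _).trans h)

theorem den_lt_of_ratSize_le {q : ℚ} {P : ℕ} (h : ratSize q ≤ P) : q.den < 2 ^ P :=
  Nat.size_le.1 ((Nat.le_add_left _ _).trans h)

/-- Small optimal solutions of the linear program dual to one side of the skewed Kantorovich
distance. -/
theorem exists_small_skewDual {S : Type*} [Fintype S] {α : ℚ} (hα : 0 ≤ α) {μ ν : S → ℚ}
    (hμ : ∀ u, 0 ≤ μ u) (hν : ∀ u, 0 ≤ ν u) {P : ℕ} (hS : Fintype.card S ≤ P)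
    (hαP : ratSize α ≤ P) (hμP : ∀ u, ratSize (μ u) ≤ P) (hνP : ∀ u, ratSize (ν u) ≤ P)
    {d : S → S → ℝ} (hd : ∀ v w, 0 ≤ d v w) {V : ℝ}
    (hV : ∀ f : S → ℝ, (∀ u, 0 ≤ f u) → (∀ u, f u ≤ 1) →
      (∀ v w, f v - α * f w ≤ d v w) → ∑ u, f u * μ u - α * ∑ u, f u * ν u ≤ V) :
    ∃ (D : ℕ) (y : S → S → ℕ) (z : ℕ), 0 < D ∧ D ≤ 2 ^ (12 * P ^ 2) ∧
      (∀ v w, y v w ≤ 2 ^ (12 * P ^ 2)) ∧ z ≤ P * 2 ^ (12 * P ^ 2) ∧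
      ∑ v, ∑ w, (y v w : ℝ) * d v w + z ≤ D * V ∧
      ∀ (e : S → S → ℝ) (f : S → ℝ), (∀ u, 0 ≤ f u) → (∀ u, f u ≤ 1) →
        (∀ v w, f v - α * f w ≤ e v w) →
        D * (∑ u, f u * μ u - α * ∑ u, f u * ν u) ≤ ∑ v, ∑ w, (y v w : ℝ) * e v w + z := by
  classical
  -- Dual variables: one per constraint `f v - α * f w ≤ d v w` and one per constraint `f t ≤ 1`;
  -- the rows correspond to the unknowns `f u`.
  let A : S → (S × S) ⊕ S → ℝ := fun u => Sum.elim
    (fun p => (if p.1 = u then -1 else 0) + if p.2 = u then (α : ℝ) else 0)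
    fun t => if t = u then -1 else 0
  let b : S → ℝ := fun u => α * ν u - μ u
  have hcolP : ∀ (f : S → ℝ) (v w : S), ∑ u, f u * A u (.inl (v, w)) = -(f v - α * f w) := by
    intro f v w
    simp only [A, Sum.elim_inl, mul_add, Finset.sum_add_distrib, mul_ite, mul_neg, mul_one,
      mul_zero, Finset.sum_ite_eq, Finset.mem_univ, if_true]
    ring
  have hcolS : ∀ (f : S → ℝ) (t : S), ∑ u, f u * A u (.inr t) = -f t := by
    intro f t
    simp [A]
  have hobj : ∀ f : S → ℝ, ∑ u, f u * b u = -(∑ u, f u * μ u - α * ∑ u, f u * ν u) := by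
    intro f
    simp only [b, Finset.mul_sum, ← Finset.sum_sub_distrib, ← Finset.sum_neg_distrib]
    exact Finset.sum_congr rfl fun u _ => by ring
  have hαν0 : ∀ u, (0 : ℝ) ≤ α * ν u := fun u => by exact_mod_cast mul_nonneg hα (hν u)
  set c : (S × S) ⊕ S → ℝ := Sum.elim (fun p => d p.1 p.2) fun _ => 1 with hc
  have hc0 : ∀ j, 0 ≤ c j := by rintro (⟨v, w⟩ | t) <;> simp [hc, hd]
  -- The starting point puts weight `μ t` on the constraint `f t ≤ 1` and nothing elsewhere; it is
  -- feasible because `α * ν ≥ 0`.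
  obtain ⟨x, hx, hAx, hcx⟩ := exists_feasible_le_of_forall_dual_le A b c V
    (x₀ := Sum.elim (fun _ => 0) fun t => (μ t : ℝ))
    (by rintro (_ | t) <;> simp [hμ])
    (fun u => by simp [Fintype.sum_sum_type, A, b]; exact_mod_cast hαν0 u)
    (fun f hf0 hf => by
      rw [hobj, neg_neg]
      refine hV f hf0 (fun u => ?_) fun v w => ?_
      · have := hf (.inr u)
        rw [hcolS] at this
        simp only [hc, Sum.elim_inr] at this
        linarith
      · have := hf (.inl (v, w))
        rw [hcolP] at this
        simp only [hc, Sum.elim_inl] at this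
        linarith)
  -- Row `u` is multiplied by `N u` to clear denominators. Each entry becomes a product of three
  -- numbers below `2 ^ P`, or a difference of two such products, hence the exponent `3 * P`.
  let N : S → ℕ := fun u => α.den * (μ u).den * (ν u).den
  have hN : ∀ u, (0 : ℝ) < N u := fun u => by
    have : 0 < N u := Nat.mul_pos (Nat.mul_pos α.den_pos (μ u).den_pos) (ν u).den_pos
    exact_mod_cast this
  let αN : S → ℕ := fun u => α.num.natAbs * (μ u).den * (ν u).den
  have num_cast : ∀ q : ℚ, 0 ≤ q → ((q.num.natAbs : ℕ) : ℝ) = q * q.den := fun q hq => by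
    have h1 : ((q.num.natAbs : ℕ) : ℤ) = q.num := Int.natAbs_of_nonneg (Rat.num_nonneg.2 hq)
    have h2 : ((q.num.natAbs : ℕ) : ℚ) = q * q.den := by
      rw [Rat.mul_den_eq_num, ← h1]; simp
    exact_mod_cast h2
  have hαN : ∀ u, (αN u : ℝ) = N u * α := fun u => by
    simp only [αN, N, Nat.cast_mul, num_cast α hα]
    ring
  let AZ : S → (S × S) ⊕ S → ℤ := fun u => Sum.elim
    (fun p => (if p.1 = u then -(N u : ℤ) else 0) + if p.2 = u then (αN u : ℤ) else 0)
    fun t => if t = u then -(N u : ℤ) else 0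
  let bZ : S → ℤ := fun u =>
    (α.num.natAbs * (μ u).den * (ν u).num.natAbs : ℕ) -
      (α.den * (μ u).num.natAbs * (ν u).den : ℕ)
  have hAZ : ∀ u j, (AZ u j : ℝ) = N u * A u j := by
    rintro u (⟨v, w⟩ | t)
    · simp only [AZ, A, Sum.elim_inl]
      push_cast [hαN]
      split_ifs <;> ring
    · simp only [AZ, A, Sum.elim_inr]
      split_ifs <;> simp
  have hbZ : ∀ u, (bZ u : ℝ) = N u * b u := fun u => by
    simp only [bZ, Int.cast_sub, Int.cast_natCast]
    simp only [b, N, Nat.cast_mul, num_cast α hα, num_cast _ (hμ u), num_cast _ (hν u)]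
    ring
  have hprod : ∀ p q r : ℕ, p < 2 ^ P → q < 2 ^ P → r < 2 ^ P → p * q * r ≤ 2 ^ (3 * P) := by
    intro p q r hp hq hr
    calc p * q * r ≤ 2 ^ P * 2 ^ P * 2 ^ P := by gcongr
      _ = 2 ^ (3 * P) := by ring
  have hNle : ∀ u, ((N u : ℕ) : ℤ) ≤ 2 ^ (3 * P) := fun u => by
    exact_mod_cast hprod _ _ _ (den_lt_of_ratSize_le hαP) (den_lt_of_ratSize_le (hμP u))
      (den_lt_of_ratSize_le (hνP u))
  have hαNle : ∀ u, ((αN u : ℕ) : ℤ) ≤ 2 ^ (3 * P) := fun u => by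
    exact_mod_cast hprod _ _ _ (num_natAbs_lt_of_ratSize_le hαP) (den_lt_of_ratSize_le (hμP u))
      (den_lt_of_ratSize_le (hνP u))
  have hpow : (0 : ℤ) ≤ 2 ^ (3 * P) := by positivity
  have hAle : ∀ u j, |AZ u j| ≤ 2 ^ (3 * P) := by
    rintro u (⟨v, w⟩ | t)
    · have := hNle u
      have := hαNle u
      have h1 : (0 : ℤ) ≤ N u := Int.natCast_nonneg _
      have h2 : (0 : ℤ) ≤ αN u := Int.natCast_nonneg _
      simp only [AZ, Sum.elim_inl, abs_le]
      split_ifs <;> constructor <;> linarith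
    · have := hNle u
      have h1 : (0 : ℤ) ≤ N u := Int.natCast_nonneg _
      simp only [AZ, Sum.elim_inr, abs_le]
      split_ifs <;> constructor <;> linarith
  have hble : ∀ u, |bZ u| ≤ 2 ^ (3 * P) := fun u => by
    have h1 := hprod _ _ _ (num_natAbs_lt_of_ratSize_le hαP) (den_lt_of_ratSize_le (hμP u))
      (num_natAbs_lt_of_ratSize_le (hνP u))
    have h2 := hprod _ _ _ (den_lt_of_ratSize_le hαP) (num_natAbs_lt_of_ratSize_le (hμP u))
      (den_lt_of_ratSize_le (hνP u))
    have h1' : ((α.num.natAbs * (μ u).den * (ν u).num.natAbs : ℕ) : ℤ) ≤ 2 ^ (3 * P) := by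
      exact_mod_cast h1
    have h2' : ((α.den * (μ u).num.natAbs * (ν u).den : ℕ) : ℤ) ≤ 2 ^ (3 * P) := by
      exact_mod_cast h2
    have h3 := Int.natCast_nonneg (α.num.natAbs * (μ u).den * (ν u).num.natAbs)
    have h4 := Int.natCast_nonneg (α.den * (μ u).num.natAbs * (ν u).den)
    exact abs_le.2 ⟨by simp only [bZ]; linarith, by simp only [bZ]; linarith⟩
  have hscale : ∀ (x : (S × S) ⊕ S → ℝ) (u : S),
      ∑ j, (AZ u j : ℝ) * x j = N u * ∑ j, A u j * x j := fun x u => by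
    rw [Finset.mul_sum]
    exact Finset.sum_congr rfl fun j _ => by rw [hAZ]; ring
  obtain ⟨D, n, hD, hDle, hn, hAn, hcn⟩ := exists_nat_feasible_le AZ bZ hS
    (Nat.lt_two_pow_self.le.trans (Nat.pow_le_pow_right two_pos (by omega))) hAle hble hc0 hx
    (fun u => by
      rw [hscale, hbZ]
      exact mul_le_mul_of_nonneg_left (hAx u) (hN u).le)
  have hexp : 4 * (3 * P) * P = 12 * P ^ 2 := by ring
  rw [hexp] at hDle hn
  have hAn' : ∀ u, ∑ j, A u j * (n j : ℝ) ≤ D * b u := fun u => by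
    have := hAn u
    rw [hscale (fun j => n j), hbZ, mul_left_comm] at this
    exact le_of_mul_le_mul_left this (hN u)
  refine ⟨D, fun v w => n (.inl (v, w)), ∑ t, n (.inr t), hD, hDle, fun v w => hn _, ?_, ?_, ?_⟩
  · calc ∑ t, n (.inr t) ≤ ∑ _t : S, 2 ^ (12 * P ^ 2) := Finset.sum_le_sum fun t _ => hn _
      _ = Fintype.card S * 2 ^ (12 * P ^ 2) := by simp
      _ ≤ P * 2 ^ (12 * P ^ 2) := by gcongr
  · refine le_trans (le_of_eq ?_) (hcn.trans (mul_le_mul_of_nonneg_left hcx (Nat.cast_nonneg D)))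
    simp only [hc, Fintype.sum_sum_type, Sum.elim_inl, Sum.elim_inr, Fintype.sum_prod_type,
      one_mul, Nat.cast_sum, mul_comm (d _ _)]
  -- Weak duality: the dual constraints do not mention `d`, so the same solution serves every `e`.
  · intro e f hf0 hf1 hfe
    have h1 : ∑ u, f u * ∑ j, A u j * (n j : ℝ) ≤ ∑ u, f u * (D * b u) :=
      Finset.sum_le_sum fun u _ => mul_le_mul_of_nonneg_left (hAn' u) (hf0 u)
    have h2 : ∑ u, f u * (D * b u) = -(D * (∑ u, f u * μ u - α * ∑ u, f u * ν u)) := by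
      rw [← mul_neg, ← hobj, Finset.mul_sum]
      exact Finset.sum_congr rfl fun u _ => by ring
    have h3 : ∑ u, f u * ∑ j, A u j * (n j : ℝ) = ∑ j, (n j : ℝ) * ∑ u, f u * A u j := by
      simp only [Finset.mul_sum]
      rw [Finset.sum_comm]
      exact Finset.sum_congr rfl fun j _ => Finset.sum_congr rfl fun u _ => by ring
    rw [h2, h3, Fintype.sum_sum_type, Fintype.sum_prod_type] at h1
    simp only [hcolP, hcolS, mul_neg, Finset.sum_neg_distrib] at h1
    have h4 : ∑ v, ∑ w, (n (.inl (v, w)) : ℝ) * (f v - α * f w) ≤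
        ∑ v, ∑ w, (n (.inl (v, w)) : ℝ) * e v w :=
      Finset.sum_le_sum fun v _ => Finset.sum_le_sum fun w _ =>
        mul_le_mul_of_nonneg_left (hfe v w) (Nat.cast_nonneg _)
    have h5 : ∑ t, (n (.inr t) : ℝ) * f t ≤ ∑ t, (n (.inr t) : ℝ) :=
      Finset.sum_le_sum fun t _ => mul_le_of_le_one_right (Nat.cast_nonneg _) (hf1 t)
    push_cast
    linarith

/-! ### Symmetry and fixed-point properties of the distance. -/

theorem skewDist_comm (α x y : ℝ) : skewDist α x y = skewDist α y x := by
  rw [skewDist, skewDist, max_comm (x - α * y)]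

theorem skewKantorovich_swap {S : Type*} [Fintype S] (α : ℝ) (d : S → S → I)
    (μ ν : stdSimplex ℝ S) :
    skewKantorovich α (fun s t => d t s) μ ν = skewKantorovich α d ν μ := by
  unfold skewKantorovich skewKantorovichSet
  congr 1
  ext x
  refine exists_congr fun f => and_congr ?_ ?_
  · rw [forall_comm]
    simp only [skewDist_comm α (f _) (f _)]
  · rw [skewDist_comm]

namespace LMC

variable {S A : Type*} [Fintype S]

theorem gamma_bd (M : LMC S A) {α : ℝ} (hα : 1 ≤ α) : M.gamma α hα (M.bd α hα) = M.bd α hα :=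
  OrderHom.map_lfp _

theorem bd_le_of_gamma_le (M : LMC S A) {α : ℝ} (hα : 1 ≤ α) {d : S → S → I}
    (h : M.gamma α hα d ≤ d) : M.bd α hα ≤ d :=
  OrderHom.lfp_le _ h

theorem gamma_of_label_eq (M : LMC S A) {α : ℝ} (hα : 1 ≤ α) (d : S → S → I) {s t : S}
    (h : M.label s = M.label t) :
    (M.gamma α hα d s t : ℝ) = skewKantorovich α d (M.next s) (M.next t) :=
  congrArg Subtype.val (if_pos h)

theorem gamma_of_label_ne (M : LMC S A) {α : ℝ} (hα : 1 ≤ α) (d : S → S → I) {s t : S}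
    (h : M.label s ≠ M.label t) : M.gamma α hα d s t = 1 :=
  if_neg h

theorem gamma_swap (M : LMC S A) {α : ℝ} (hα : 1 ≤ α) (d : S → S → I) (s t : S) :
    M.gamma α hα (fun s t => d t s) s t = M.gamma α hα d t s := by
  by_cases h : M.label s = M.label t
  · rw [← Subtype.coe_inj, gamma_of_label_eq _ _ _ h, gamma_of_label_eq _ _ _ h.symm,
      skewKantorovich_swap]
  · rw [gamma_of_label_ne _ _ _ h, gamma_of_label_ne _ _ _ (Ne.symm h)]

/-- `gamma` commutes with transposition, so the transpose of `bd` is again a fixed point and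
leastness applies. -/
theorem bd_comm (M : LMC S A) {α : ℝ} (hα : 1 ≤ α) (s t : S) :
    M.bd α hα s t = M.bd α hα t s := by
  have h : ∀ s t, M.bd α hα s t ≤ M.bd α hα t s :=
    M.bd_le_of_gamma_le hα (d := fun s t => M.bd α hα t s) fun s t => by
      rw [gamma_swap, gamma_bd]
  exact le_antisymm (h s t) (h t s)

/-- By symmetry of `bd`, the one-sided linear constraints for all ordered pairs already give the
full `skewDist` constraints. This lets the program of `exists_small_skewDual` use one-sided
constraints only. -/
theorem skewDist_expect_le_bd (M : LMC S A) {α : ℝ} (hα : 1 ≤ α) {s t : S}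
    (h : M.label s = M.label t) (f : S → I)
    (hf : ∀ v w, (f v : ℝ) - α * f w ≤ M.bd α hα v w) :
    skewDist α (expect f (M.next s)) (expect f (M.next t)) ≤ M.bd α hα s t := by
  rw [← gamma_bd, gamma_of_label_eq _ _ _ h]
  refine le_csSup (skewKantorovichSet_bddAbove hα _ _ _) ⟨f, fun v w => ?_, rfl⟩
  refine max_le (max_le (hf v w) ?_) (M.bd α hα v w).2.1
  rw [bd_comm]
  exact hf w v

theorem card_le_size [Fintype A] (M : LMC S A) : Fintype.card S ≤ M.size := by
  refine le_trans ?_ (Nat.le_add_right _ _)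
  calc Fintype.card S = ∑ _s : S, 1 := by simp
    _ ≤ _ := Finset.sum_le_sum fun _ _ => Nat.le_add_right _ _

theorem ratSize_trans_le_size [Fintype A] (M : LMC S A) (s u : S) :
    ratSize (M.trans s u) ≤ M.size := by
  refine le_trans ?_ (Nat.le_add_left _ _)
  exact (Finset.single_le_sum (f := fun u => ratSize (M.trans s u)) (fun _ _ => Nat.zero_le _)
    (Finset.mem_univ u)).trans
    (Finset.single_le_sum (f := fun s => ∑ u, ratSize (M.trans s u)) (fun _ _ => Nat.zero_le _)
      (Finset.mem_univ s))

/-! ### Certificates for the fixed point and the final linear program. -/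

/-- Each side of the fixed point equation for `bd` at a pair of states is implied by a linear
inequality with small integer coefficients that holds for `bd`. -/
theorem exists_small_certificate [Fintype A] (M : LMC S A) {α : ℚ} (hα : 1 ≤ (α : ℝ)) {P : ℕ}
    (hP : M.size + ratSize α ≤ P) (s t : S) (i : Bool) :
    ∃ (D : ℕ) (y : S → S → ℕ) (z : ℕ), 0 < D ∧ D ≤ 2 ^ (12 * P ^ 2) ∧
      (∀ v w, y v w ≤ 2 ^ (12 * P ^ 2)) ∧ z ≤ P * 2 ^ (12 * P ^ 2) ∧
      ∑ v, ∑ w, (y v w : ℝ) * M.bd α hα v w + z ≤ D * M.bd α hα s t ∧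
      ∀ e : S → S → I, ∑ v, ∑ w, (y v w : ℝ) * e v w + z ≤ D * e s t →
        (M.label s ≠ M.label t → (1 : ℝ) ≤ e s t) ∧
        (M.label s = M.label t → ∀ f : S → I, (∀ v w, skewDist α (f v) (f w) ≤ e v w) →
          expect f (M.next (if i then s else t)) - α * expect f (M.next (if i then t else s)) ≤
            e s t) := by
  have hcard : Fintype.card S ≤ P := M.card_le_size.trans (le_of_add_le_left hP)
  by_cases h : M.label s = M.label t
  · set s' := if i then s else t with hs'
    set t' := if i then t else s
    obtain ⟨D, y, z, hD, hDle, hy, hz, hbd, hdual⟩ := exists_small_skewDual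
      (α := α) (μ := M.trans s') (ν := M.trans t') (P := P)
      (by exact_mod_cast zero_le_one.trans hα)
      (M.trans_nonneg s') (M.trans_nonneg t') hcard (le_of_add_le_right hP)
      (fun u => (M.ratSize_trans_le_size _ u).trans (le_of_add_le_left hP))
      (fun u => (M.ratSize_trans_le_size _ u).trans (le_of_add_le_left hP))
      (d := fun v w => M.bd α hα v w) (fun v w => (M.bd α hα v w).2.1) (V := M.bd α hα s t)
      (fun f hf0 hf1 hf => by
        have := M.skewDist_expect_le_bd hα h (fun u => ⟨f u, hf0 u, hf1 u⟩) hf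
        refine le_trans ?_ this
        cases i
        · exact (le_max_right _ _).trans (le_max_left _ _)
        · exact (le_max_left _ _).trans (le_max_left _ _))
    refine ⟨D, y, z, hD, hDle, hy, hz, hbd, fun e he => ⟨fun hne => absurd h hne, fun _ f hf => ?_⟩⟩
    have := (hdual (fun v w => e v w) (fun u => f u) (fun u => (f u).2.1) (fun u => (f u).2.2)
      fun v w => ((le_max_left _ _).trans (le_max_left _ _)).trans (hf v w)).trans he
    exact le_of_mul_le_mul_left this (by exact_mod_cast hD)
  · have hP1 : 1 ≤ P := (Fintype.card_pos_iff.2 ⟨s⟩).trans_le hcard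
    -- With different labels the certificate is simply `1 ≤ e s t`.
    refine ⟨1, 0, 1, one_pos, Nat.one_le_two_pow, fun _ _ => Nat.zero_le _,
      Nat.mul_pos hP1 (by positivity), ?_, fun e he => ⟨fun _ => ?_, fun h' => absurd h' h⟩⟩
    · rw [← gamma_bd, gamma_of_label_ne _ _ _ h]
      simp
    · simpa using he

theorem exists_rat_bd_eq [Fintype A] (M : LMC S A) {α : ℚ} (hα : 1 ≤ (α : ℝ)) (s t : S) :
    ∃ q : ℚ, (M.bd (α : ℝ) hα s t : ℝ) = q ∧ ratSize q ≤ 312 * (M.size + ratSize α) ^ 4 + 2 := by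
  classical
  set P := M.size + ratSize α with hP
  have hcard : Fintype.card S ≤ P := M.card_le_size.trans (Nat.le_add_right _ _)
  have hP1 : 1 ≤ P := (Fintype.card_pos_iff.2 ⟨s⟩).trans_le hcard
  choose D y z hD hDle hy hz hbd hcert using M.exists_small_certificate hα hP.ge
  -- Three rows per pair: `none` encodes `e ≤ 1`, and `some i` encodes the certificate for side `i`.
  let B : (S × S) × Option Bool → S × S → ℤ
    | (p, none), q => if q = p then 1 else 0
    | (p, some i), q => y p.1 p.2 i q.1 q.2 - if q = p then (D p.1 p.2 i : ℤ) else 0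
  let b : (S × S) × Option Bool → ℤ
    | (_, none) => 1
    | (p, some i) => -(z p.1 p.2 i : ℤ)
  have hBnone : ∀ (x : S × S → ℝ) p, ∑ q, (B (p, none) q : ℝ) * x q = x p := by
    intro x p
    simp [B]
  have hBsome : ∀ (x : S × S → ℝ) p i, ∑ q, (B (p, some i) q : ℝ) * x q =
      ∑ v, ∑ w, (y p.1 p.2 i v w : ℝ) * x (v, w) - D p.1 p.2 i * x p := by
    intro x p i
    simp only [B, Int.cast_sub, Int.cast_natCast, Int.cast_ite, Int.cast_zero, sub_mul, ite_mul,
      zero_mul, Finset.sum_sub_distrib, Finset.sum_ite_eq', Finset.mem_univ, if_true,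
      Fintype.sum_prod_type]
  have hpow : 2 ^ (12 * P ^ 2) ≤ 2 ^ (13 * P ^ 2) := Nat.pow_le_pow_right two_pos (by omega)
  have hpow1 : (1 : ℤ) ≤ 2 ^ (13 * P ^ 2) := one_le_pow₀ (by norm_num)
  have hDZ : ∀ s t i, (D s t i : ℤ) ≤ 2 ^ (13 * P ^ 2) := fun s t i => by
    exact_mod_cast (hDle s t i).trans hpow
  have hyZ : ∀ s t i v w, (y s t i v w : ℤ) ≤ 2 ^ (13 * P ^ 2) := fun s t i v w => by
    exact_mod_cast (hy s t i v w).trans hpow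
  have hzZ : ∀ s t i, (z s t i : ℤ) ≤ 2 ^ (13 * P ^ 2) := fun s t i => by
    have : z s t i ≤ 2 ^ (13 * P ^ 2) := by
      calc z s t i ≤ P * 2 ^ (12 * P ^ 2) := hz s t i
        _ ≤ 2 ^ (P ^ 2) * 2 ^ (12 * P ^ 2) := by
          gcongr
          exact Nat.lt_two_pow_self.le.trans
            (Nat.pow_le_pow_right two_pos (Nat.le_self_pow two_ne_zero P))
        _ = 2 ^ (13 * P ^ 2) := by rw [← pow_add]; ring
    exact_mod_cast this
  -- All costs are `1` and the given feasible point is `bd` itself, so the short point `n / E` has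
  -- coordinate sum at most that of `bd`.
  obtain ⟨E, n, hE, hEle, hn, hBn, hcn⟩ := exists_nat_feasible_le (k := 3 * P ^ 2)
    (a := 13 * P ^ 2) B b
    (by
      simp only [Fintype.card_prod, Fintype.card_option, Fintype.card_bool]
      nlinarith [Nat.mul_le_mul hcard hcard])
    (Nat.lt_two_pow_self.le.trans (Nat.pow_le_pow_right two_pos (by omega)))
    (by
      rintro ⟨p, _ | i⟩ q
      · simp only [B]
        split_ifs <;> simp [hpow1]
      · have := hDZ p.1 p.2 i
        have := hyZ p.1 p.2 i q.1 q.2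
        have h1 := Int.natCast_nonneg (D p.1 p.2 i)
        have h2 := Int.natCast_nonneg (y p.1 p.2 i q.1 q.2)
        simp only [B, abs_le]
        split_ifs <;> constructor <;> linarith)
    (by
      rintro ⟨p, _ | i⟩
      · simpa [b] using hpow1
      · simpa [b] using hzZ p.1 p.2 i)
    (c := fun _ => 1) (x := fun q => M.bd α hα q.1 q.2) (fun _ => zero_le_one)
    (fun q => (M.bd α hα q.1 q.2).2.1)
    (by
      rintro ⟨p, _ | i⟩
      · rw [hBnone]
        simpa [b] using (M.bd α hα p.1 p.2).2.2
      · rw [hBsome]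
        have := hbd p.1 p.2 i
        simp only [b, Int.cast_neg, Int.cast_natCast]
        linarith)
  have hE' : (0 : ℝ) < E := by exact_mod_cast hE
  have he1 : ∀ v w, (n (v, w) : ℝ) / E ≤ 1 := fun v w => by
    have := hBn ((v, w), none)
    rw [hBnone (fun q => n q)] at this
    rw [div_le_one hE']
    simpa [b] using this
  let e : S → S → I := fun v w => ⟨n (v, w) / E, by positivity, he1 v w⟩
  have hfeas : ∀ v w i, ∑ v', ∑ w', (y v w i v' w' : ℝ) * e v' w' + z v w i ≤
      D v w i * e v w := by
    intro v w i
    have := hBn ((v, w), some i)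
    rw [hBsome (fun q => n q)] at this
    simp only [b, Int.cast_neg, Int.cast_natCast] at this
    have h1 : ∑ v', ∑ w', (y v w i v' w' : ℝ) * e v' w' =
        (∑ v', ∑ w', (y v w i v' w' : ℝ) * n (v', w')) / E := by
      simp only [e, Finset.sum_div, mul_div_assoc]
    have h2 : (D v w i : ℝ) * e v w = (D v w i * n (v, w)) / E := by
      simp only [e, mul_div_assoc]
    rw [h1, h2, ← le_sub_iff_add_le', ← sub_nonneg]
    have h3 : (D v w i * n (v, w) : ℝ) / E - (∑ v', ∑ w', (y v w i v' w' : ℝ) * n (v', w')) / E -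
        z v w i = (D v w i * n (v, w) - ∑ v', ∑ w', (y v w i v' w' : ℝ) * n (v', w') -
        E * z v w i) / E := by
      field_simp
    rw [h3]
    exact div_nonneg (by linarith) hE'.le
  have hpre : M.gamma α hα e ≤ e := by
    intro v w
    by_cases h : M.label v = M.label w
    · rw [← Subtype.coe_le_coe, gamma_of_label_eq _ _ _ h]
      refine csSup_le (skewKantorovichSet_nonempty _ _ _ _) ?_
      rintro x ⟨f, hf, rfl⟩
      refine max_le (max_le ?_ ?_) (e v w).2.1
      · exact (hcert v w true e (hfeas v w true)).2 h f hf
      · exact (hcert v w false e (hfeas v w false)).2 h f hf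
    · rw [gamma_of_label_ne _ _ _ h, ← Subtype.coe_le_coe]
      exact (hcert v w true e (hfeas v w true)).1 h
  have hle := M.bd_le_of_gamma_le hα hpre
  -- `bd ≤ e` holds pointwise while the sum of `e` is at most the sum of `bd`, so every coordinate
  -- agrees.
  have heq : (M.bd α hα s t : ℝ) = n (s, t) / E := by
    have hle' : ∀ q ∈ Finset.univ, (M.bd α hα q.1 q.2 : ℝ) ≤ n q / E := fun q _ => hle q.1 q.2
    have hsum : ∑ q : S × S, (n q : ℝ) / E ≤ ∑ q : S × S, (M.bd α hα q.1 q.2 : ℝ) := by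
      simp only [one_mul] at hcn
      rw [← Finset.sum_div, div_le_iff₀' hE']
      exact hcn
    exact (Finset.sum_eq_sum_iff_of_le hle').1 (le_antisymm (Finset.sum_le_sum hle') hsum) (s, t)
      (Finset.mem_univ _)
  -- The extra bit accounts for `m` equal to the power of two; numerator and denominator together
  -- give `312 * P ^ 4 + 2`.
  have hsize : ∀ m : ℕ, m ≤ 2 ^ (4 * (13 * P ^ 2) * (3 * P ^ 2)) → Nat.size m ≤ 156 * P ^ 4 + 1 := by
    intro m hm
    rw [Nat.size_le, pow_succ]
    have : 4 * (13 * P ^ 2) * (3 * P ^ 2) = 156 * P ^ 4 := by ring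
    rw [this] at hm
    have := Nat.one_le_two_pow (n := 156 * P ^ 4)
    omega
  refine ⟨n (s, t) / E, by rw [heq]; push_cast; rfl, (ratSize_natCast_div_le _ _ hE).trans ?_⟩
  have := hsize _ (hn (s, t))
  have := hsize _ hEle
  omega

end LMC

theorem theorem1 :
    ∃ p : Polynomial ℕ,
      ∀ (α : ℚ) (hα : 1 ≤ (α : ℝ)) (S : Type*) (A : Type*) [Fintype S] [Fintype A]
        (M : LMC S A) (s t : S),
        ∃ q : ℚ, (M.bd (α : ℝ) hα s t : ℝ) = (q : ℝ) ∧
          ratSize q ≤ p.eval (M.size + ratSize α) := by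
  refine ⟨312 * Polynomial.X ^ 4 + 2, fun α hα S A _ _ M s t => ?_⟩
  simpa using M.exists_rat_bd_eq hα s t
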